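/- Let $k$ be an algebraically closed field in which $2$ is invertible, let $\ell\ge 1$, let $M$ be a $k$-vector space of dimension $2\ell+1$, and put $n=2^{\ell}$. Let $Q$ be the affine space (over $k$) of quadratic forms on $M$. For $q\in Q$ let $\mathrm{C}\ell_q$ be its Clifford algebra and $\mathrm{C}\ell^+_q$ the even part of $\mathrm{C}\ell_q$. A $k$-algebra $A_0$ of dimension $n^2$ (associative, with $1$) is a *specialisation of the matrix algebra $\mathcal M_n$* if there are a discrete valuation ring $R$ over $k$ with residue field $k$ and fraction field $K$, and an $R$-algebra $A$, free as an $R$-module, such that $A\otimes_R\overline K\simeq \mathcal M_n(\overline K)$ and $A\otimes_R k\simeq A_0$ as algebras. Let $V=\Lambda^{+}M$ be the even part of the exterior algebra of $M$ (so $\dim V=n^2$), let $e_0=1\in V$, and let $\mathcal A_n$ be the variety, a reduced closed subscheme of the affine space $\operatorname{Hom}(V\otimes V,V)$, of those associative algebra structures on $V$ with identity element $e_0$ which are specialisations of $\mathcal M_n$. Choose, linearly in $q$, a bilinear form $\beta_q$ on $M$ with $\beta_q(x,x)=q(x)$ for all $x$, and identify $V$ with $\mathrm{C}\ell^+_q$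 by the restriction of the linear isomorphism $\lambda_q:\Lambda M\to \mathrm{C}\ell_q$ given by $\lambda_q(1)=1$ and $\lambda_q(a\wedge x)=a\,\lambda_q(x)-\beta_q(a,\cdot)\,\lrcorner\,\lambda_q(x)$ for $a\in M$. (For symmetric $\beta_q$ this is antisymmetrisation; if $\beta_q(e_i,e_j)=0$ for all $i<j$ in a basis $(e_i)$ of $M$, then it sends $e_{i_1}\wedge\dots\wedge e_{i_r}$ to $e_{i_1}\cdots e_{i_r}$ for $i_1<\dots<i_r$.) Let $\theta(q)$ be the algebra structure on $V$ obtained from $\mathrm{C}\ell^+_q$ in this way. Then $\theta(q)$ is a specialisation of $\mathcal M_n$ for every $q$, and $q\mapsto\theta(q)$ is a morphism of $k$-schemes $\theta:Q\to\mathcal A_n$ which is a closed embedding (closed immersion). -/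

import Mathlib

open CategoryTheory AlgebraicGeometry
open scoped TensorProduct

universe u

namespace CliffordSpecialisation

noncomputable section

/-! ### Affine spaces and their reduced closed subschemes -/

section AffineSpace

variable (k : Type u) [Field k] (W : Type u) [AddCommGroup W] [Module k W]

/-- The ring of polynomial functions on the vector space `W`: the symmetric algebra of its dual. -/
abbrev CoordRing : Type u := SymmetricAlgebra k (Module.Dual k W)

/-- The affine space of the (finite dimensional) vector space `W`, as a scheme. -/
abbrev affineSpace : Scheme.{u} := Spec (.of (CoordRing k W))

/-- The structure morphism of the affine space of `W` to `Spec k`. -/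
def affineSpaceStr : affineSpace k W ⟶ Spec (.of k) :=
  Spec.map (CommRingCat.ofHom (algebraMap k (CoordRing k W)))

variable {W}

/-- Evaluation of polynomial functions at the vector `w`. -/
def evalAt (w : W) : CoordRing k W →ₐ[k] k :=
  SymmetricAlgebra.lift (Module.Dual.eval k W w)

/-- The `k`-rational point of the affine space of `W` given by the vector `w`. -/
def point (w : W) : Spec (.of k) ⟶ affineSpace k W :=
  Spec.map (CommRingCat.ofHom (evalAt k w).toRingHom)

/-- The ideal of all polynomial functions that vanish on the set `S` of vectors. -/
def vanishingIdeal (S : Set W) : Ideal (CoordRing k W) :=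
  ⨅ w ∈ S, RingHom.ker (evalAt k w)

/-- The reduced closed subscheme of the affine space of `W` that is determined by the set `S` of
`k`-rational points (if `S` is Zariski closed and `k` is algebraically closed, then `S` is its set
of `k`-rational points). -/
abbrev subvariety (S : Set W) : Scheme.{u} := Spec (.of (CoordRing k W ⧸ vanishingIdeal k S))

/-- The inclusion of `subvariety k S` into the affine space. -/
def subvarietyIncl (S : Set W) : subvariety k S ⟶ affineSpace k W :=
  Spec.map (CommRingCat.ofHom (Ideal.Quotient.mk (vanishingIdeal k S)))

end AffineSpace

/-! ### Specialisations of the matrix algebra -/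

section Specialisation

variable (k : Type u) [Field k]

/-- The `k`-algebra `A₀` is a specialisation of the algebra of `n × n` matrices: it has dimension
`n ^ 2`, and there are a discrete valuation ring `R` over `k` with residue field `k` and an
`R`-algebra `A`, free as an `R`-module, whose geometric generic fibre is the matrix algebra and
whose special fibre is `A₀`. -/
def IsSpecialisation (n : ℕ) (A₀ : Type u) [Ring A₀] [Algebra k A₀] : Prop :=
  Module.finrank k A₀ = n ^ 2 ∧
  ∃ (R : Type u) (_ : CommRing R) (_ : IsDomain R) (_ : IsDiscreteValuationRing R)
    (_ : Algebra k R) (A : Type u) (_ : Ring A) (_ : Algebra R A),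
    Function.Bijective (algebraMap k (IsLocalRing.ResidueField R)) ∧
    Module.Free R A ∧
    Nonempty ((AlgebraicClosure (FractionRing R) ⊗[R] A)
      ≃ₐ[AlgebraicClosure (FractionRing R)]
        Matrix (Fin n) (Fin n) (AlgebraicClosure (FractionRing R))) ∧
    Nonempty ((IsLocalRing.ResidueField R ⊗[R] A) ≃ₐ[k] A₀)

/-- The set of those bilinear multiplications on the vector space `V` which make `V` an associative
algebra with identity element `e₀` that is a specialisation of the algebra of `n × n` matrices. -/
def specialisations (n : ℕ) {V : Type u} [AddCommGroup V] [Module k V] (e₀ : V) :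
    Set (V →ₗ[k] V →ₗ[k] V) :=
  {μ | ∃ (A₀ : Type u) (_ : Ring A₀) (_ : Algebra k A₀) (φ : V ≃ₗ[k] A₀),
    φ e₀ = 1 ∧ (∀ x y, φ (μ x y) = φ x * φ y) ∧ IsSpecialisation k n A₀}

/-- The variety `𝒜ₙ` of specialisations of the algebra of `n × n` matrices, as a reduced closed
subscheme of the affine space of bilinear multiplications on `V`. -/
abbrev specialisationVariety (n : ℕ) {V : Type u} [AddCommGroup V] [Module k V] (e₀ : V) :
    Scheme.{u} :=
  subvariety k (specialisations k n e₀)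

end Specialisation

/-! ### The even Clifford algebra as a multiplication on the even exterior algebra -/

section Clifford

variable {k : Type u} [Field k] {M : Type u} [AddCommGroup M] [Module k M]

theorem contractLeft_mem_evenOdd {q : QuadraticForm k M} (d : Module.Dual k M) (i : ZMod 2)
    {x : CliffordAlgebra q} (hx : x ∈ CliffordAlgebra.evenOdd q i) :
    CliffordAlgebra.contractLeft d x ∈ CliffordAlgebra.evenOdd q (i + 1) := by
  induction x, hx using CliffordAlgebra.evenOdd_induction with
  | range_ι_pow v h =>
    fin_cases i
    · obtain ⟨r, rfl⟩ := Submodule.mem_one.mp h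
      rw [CliffordAlgebra.contractLeft_algebraMap]
      exact Submodule.zero_mem _
    · have h' : v ∈ LinearMap.range (CliffordAlgebra.ι q) ^ 1 := h
      rw [pow_one] at h'
      obtain ⟨a, rfl⟩ := h'
      rw [CliffordAlgebra.contractLeft_ι]
      exact SetLike.algebraMap_mem_graded (CliffordAlgebra.evenOdd q) _
  | add x y hx hy ihx ihy =>
    rw [map_add]
    exact Submodule.add_mem _ ihx ihy
  | ι_mul_ι_mul a b x hx ih =>
    rw [mul_assoc, CliffordAlgebra.contractLeft_ι_mul, CliffordAlgebra.contractLeft_ι_mul, mul_sub,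
      mul_smul_comm, ← mul_assoc]
    have hι : ∀ c y, y ∈ CliffordAlgebra.evenOdd q i →
        CliffordAlgebra.ι q c * y ∈ CliffordAlgebra.evenOdd q (i + 1) := fun c y hy =>
      add_comm (1 : ZMod 2) i ▸
        SetLike.mul_mem_graded (CliffordAlgebra.ι_mem_evenOdd_one q c) hy
    refine Submodule.sub_mem _ (Submodule.smul_mem _ _ (hι _ _ hx)) (Submodule.sub_mem _
      (Submodule.smul_mem _ _ (hι _ _ hx)) ?_)
    exact zero_add (i + 1) ▸
      SetLike.mul_mem_graded (CliffordAlgebra.ι_mul_ι_mem_evenOdd_zero q a b) ih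

theorem changeForm_mem_even {q q' : QuadraticForm k M} {B : LinearMap.BilinForm k M}
    (h : B.toQuadraticMap = q' - q) {x : CliffordAlgebra q} (hx : x ∈ CliffordAlgebra.even q) :
    CliffordAlgebra.changeForm h x ∈ CliffordAlgebra.even q' := by
  change x ∈ CliffordAlgebra.evenOdd q 0 at hx
  change _ ∈ CliffordAlgebra.evenOdd q' 0
  induction x, hx using CliffordAlgebra.even_induction with
  | algebraMap r =>
    rw [CliffordAlgebra.changeForm_algebraMap]
    exact SetLike.algebraMap_mem_graded (CliffordAlgebra.evenOdd q') _
  | add x y hx hy ihx ihy =>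
    rw [map_add]
    exact Submodule.add_mem _ ihx ihy
  | ι_mul_ι_mul a b x hx ih =>
    have h1 : CliffordAlgebra.changeForm h (CliffordAlgebra.ι q b * x) ∈
        CliffordAlgebra.evenOdd q' 1 := by
      rw [CliffordAlgebra.changeForm_ι_mul]
      refine Submodule.sub_mem _ ?_ ?_
      · exact add_zero (1 : ZMod 2) ▸
          SetLike.mul_mem_graded (CliffordAlgebra.ι_mem_evenOdd_one q' b) ih
      · exact zero_add (1 : ZMod 2) ▸ contractLeft_mem_evenOdd _ _ ih
    have h11 : (1 : ZMod 2) + 1 = 0 := rfl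
    rw [mul_assoc, CliffordAlgebra.changeForm_ι_mul]
    refine Submodule.sub_mem _ ?_ ?_
    · exact h11 ▸ SetLike.mul_mem_graded (CliffordAlgebra.ι_mem_evenOdd_one q' a) h1
    · exact h11 ▸ contractLeft_mem_evenOdd _ _ h1

variable (k M) in
/-- The even part of the exterior algebra of `M`, as the even Clifford algebra of the zero form
(in Mathlib, `ExteriorAlgebra k M` is by definition the Clifford algebra of the zero form). -/
abbrev EvenExterior : Type u := CliffordAlgebra.even (0 : QuadraticForm k M)

/-- For a bilinear form `B` with `B x x = q x`, the induced isomorphism of vector spaces from the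
even exterior algebra to the even Clifford algebra of `q`. It is the restriction of the isomorphism
`λ` from the exterior algebra to the Clifford algebra with `λ 1 = 1` and
`λ (a ∧ x) = a * λ x - B a ⌋ λ x`. If `B` is symmetric, then `λ` is antisymmetrisation; if
`B (e i) (e j) = 0` for `i < j` in some basis `e`, then `λ` sends every wedge monomial
`e i₁ ∧ ⋯ ∧ e iᵣ` with `i₁ < ⋯ < iᵣ` to the product `e i₁ * ⋯ * e iᵣ`. -/
def evenIso (q : QuadraticForm k M) (B : LinearMap.BilinForm k M) (h : B.toQuadraticMap = q) :
    EvenExterior k M ≃ₗ[k] CliffordAlgebra.even q :=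
  have h' : B.toQuadraticMap = q - 0 := by rw [h, sub_zero]
  { (CliffordAlgebra.changeForm h').restrict
      (p := Subalgebra.toSubmodule (CliffordAlgebra.even (0 : QuadraticForm k M)))
      (q := Subalgebra.toSubmodule (CliffordAlgebra.even q))
      (fun _ hx => changeForm_mem_even h' hx) with
    invFun := fun y => ⟨CliffordAlgebra.changeForm (CliffordAlgebra.changeForm.neg_proof h') y.1,
      changeForm_mem_even _ y.2⟩
    left_inv := fun x => Subtype.ext ((CliffordAlgebra.changeFormEquiv h').left_inv x.1)
    right_inv := fun y => Subtype.ext ((CliffordAlgebra.changeFormEquiv h').right_inv y.1) }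

/-- The multiplication of the even Clifford algebra of `q`, transported to the even exterior
algebra along `evenIso q B h`. -/
def cliffordMul (q : QuadraticForm k M) (B : LinearMap.BilinForm k M) (h : B.toQuadraticMap = q) :
    EvenExterior k M →ₗ[k] EvenExterior k M →ₗ[k] EvenExterior k M :=
  ((LinearMap.mul k (CliffordAlgebra.even q)).compl₁₂
    (evenIso q B h).toLinearMap (evenIso q B h).toLinearMap).compr₂ (evenIso q B h).symm.toLinearMap

end Clifford

end

end CliffordSpecialisation

namespace CliffordSpecialisation

noncomputable section

/-! Over `k⟦X⟧`, the diagonal form with weights `wᵢ + X` reduces to the one with weights `wᵢ`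
modulo `X` and is nondegenerate over the fraction field. Its even Clifford algebra is free and
commutes with base change. Over an algebraically closed field, splitting off hyperbolic planes and
the isomorphism `Cl⁺(Q ⊥ ⟨-1⟩) ≃ Cl(Q)` show that the even Clifford algebra of a nondegenerate form
in `2ℓ + 1` variables is the algebra of matrices of size `2 ^ ℓ`. So every `Cl⁺(q)` is a
specialisation of that algebra.

The multiplication `⋆` which the exterior algebra inherits from `Cl(q)` satisfies
`(a ∧ x) ⋆ y = a ∧ (x ⋆ y) + α x ⋆ (β a ⌋ y)`, where `α` is the grade involution; hence it is
polynomial in `q`. Conversely, the coefficient of `b ∧ c` in `(a ∧ b) ⋆ (a ∧ c)` is `-q a` for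
linearly independent `a`, `b`, `c`, so that every linear function of `q` is a linear function of the
multiplication. As the linear functions generate the coordinate ring, the pullback of functions
along `θ` is surjective. -/

section PolynomialMaps

variable {k : Type u} [Field k] {P : Type u} [AddCommGroup P] [Module k P]
  {N N' : Type*} [AddCommGroup N] [Module k N] [AddCommGroup N'] [Module k N']

theorem evalAt_ι (p : P) (d : Module.Dual k P) :
    evalAt k p (SymmetricAlgebra.ι k _ d) = d p :=
  SymmetricAlgebra.lift_ι_apply _ _

variable (k P N) in
/-- The polynomial maps from the vector space `P` to the vector space `N`, that is, the morphisms
from `P` to `N` as affine spaces: the linear combinations of vectors of `N` with coefficients in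
the coordinate ring of `P`. -/
def polynomialMaps : Submodule k (P → N) :=
  .span k (Set.range fun (x : CoordRing k P × N) (p : P) => evalAt k p x.1 • x.2)

theorem evalAt_smul_const_mem_polynomialMaps (F : CoordRing k P) (n : N) :
    (fun p => evalAt k p F • n) ∈ polynomialMaps k P N :=
  Submodule.subset_span ⟨(F, n), rfl⟩

theorem const_mem_polynomialMaps (n : N) : (fun _ => n) ∈ polynomialMaps k P N := by
  simpa using evalAt_smul_const_mem_polynomialMaps (P := P) (1 : CoordRing k P) n

theorem linearMap_mem_polynomialMaps [Module.Finite k P] (L : P →ₗ[k] N) :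
    ⇑L ∈ polynomialMaps k P N := by
  let b := Module.finBasis k P
  have hL : ⇑L = ∑ i, fun p => evalAt k p (SymmetricAlgebra.ι k _ (b.coord i)) • L (b i) := by
    ext p
    conv_lhs => rw [← b.sum_repr p, map_sum]
    simp [evalAt_ι]
  exact hL ▸ sum_mem fun i _ => evalAt_smul_const_mem_polynomialMaps _ _

theorem exists_evalAt_eq {f : P → k} (hf : f ∈ polynomialMaps k P k) :
    ∃ F : CoordRing k P, ∀ p, evalAt k p F = f p := by
  induction hf using Submodule.span_induction with
  | mem f hf =>
    obtain ⟨⟨F, c⟩, rfl⟩ := hf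
    exact ⟨c • F, fun p => by simp [mul_comm]⟩
  | zero => exact ⟨0, fun p => by simp⟩
  | add f g _ _ hf hg =>
    obtain ⟨F, hF⟩ := hf
    obtain ⟨G, hG⟩ := hg
    exact ⟨F + G, fun p => by simp [hF, hG]⟩
  | smul c f _ hf =>
    obtain ⟨F, hF⟩ := hf
    exact ⟨c • F, fun p => by simp [hF]⟩

theorem evalAt_smul_mem_polynomialMaps (F : CoordRing k P) {f : P → N}
    (hf : f ∈ polynomialMaps k P N) : (fun p => evalAt k p F • f p) ∈ polynomialMaps k P N := by
  induction hf using Submodule.span_induction with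
  | mem f hf =>
    obtain ⟨⟨G, n⟩, rfl⟩ := hf
    simpa only [map_mul, mul_smul] using evalAt_smul_const_mem_polynomialMaps (F * G) n
  | zero => simp only [Pi.zero_apply, smul_zero]; exact zero_mem _
  | add f g _ _ hf hg => simp only [Pi.add_apply, smul_add]; exact add_mem hf hg
  | smul c f _ hf => simp only [Pi.smul_apply, smul_comm _ c]; exact Submodule.smul_mem _ c hf

theorem apply_mem_polynomialMaps {Φ : P → N →ₗ[k] N'} {f : P → N}
    (hΦ : ∀ n, (fun p => Φ p n) ∈ polynomialMaps k P N') (hf : f ∈ polynomialMaps k P N) :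
    (fun p => Φ p (f p)) ∈ polynomialMaps k P N' := by
  induction hf using Submodule.span_induction with
  | mem f hf =>
    obtain ⟨⟨F, n⟩, rfl⟩ := hf
    simpa only [map_smul] using evalAt_smul_mem_polynomialMaps F (hΦ n)
  | zero => simp only [Pi.zero_apply, map_zero]; exact zero_mem _
  | add f g _ _ hf hg => simp only [Pi.add_apply, map_add]; exact add_mem hf hg
  | smul c f _ hf => simp only [Pi.smul_apply, map_smul]; exact Submodule.smul_mem _ c hf

theorem linearMap_comp_mem_polynomialMaps (L : N →ₗ[k] N') {f : P → N}
    (hf : f ∈ polynomialMaps k P N) : (fun p => L (f p)) ∈ polynomialMaps k P N' :=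
  apply_mem_polynomialMaps (Φ := fun _ => L) (fun _ => const_mem_polynomialMaps _) hf

theorem mem_polynomialMaps_of_apply [Module.Finite k N] {m : P → N →ₗ[k] N'}
    (h : ∀ n, (fun p => m p n) ∈ polynomialMaps k P N') :
    m ∈ polynomialMaps k P (N →ₗ[k] N') := by
  let b := Module.finBasis k N
  have hm : m = ∑ i, fun p => LinearMap.smulRightₗ (b.coord i) (m p (b i)) := by
    ext p : 1
    refine b.ext fun j => ?_
    simp [Finsupp.single_apply]
  rw [hm]
  exact sum_mem fun i _ => linearMap_comp_mem_polynomialMaps _ (h (b i))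

end PolynomialMaps

section ClosedImmersion

variable {k : Type u} [Field k] {P W : Type u} [AddCommGroup P] [Module k P] [AddCommGroup W]
  [Module k W]

theorem coordRing_ext [Infinite k] [Module.Finite k P] {F G : CoordRing k P}
    (h : ∀ p, evalAt k p F = evalAt k p G) : F = G := by
  let b := Module.finBasis k P
  let e := SymmetricAlgebra.equivMvPolynomial b.dualBasis
  have he (p : P) : (MvPolynomial.aeval fun i => b.coord i p).comp e.toAlgHom = evalAt k p := by
    refine SymmetricAlgebra.algHom_ext (b.dualBasis.ext fun i => ?_)
    have hi : e (SymmetricAlgebra.ι k _ (b.dualBasis i)) = MvPolynomial.X i :=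
      SymmetricAlgebra.equivMvPolynomial_ι_apply _ _
    change MvPolynomial.aeval _ (e (SymmetricAlgebra.ι k _ (b.dualBasis i))) =
      evalAt k p (SymmetricAlgebra.ι k _ (b.dualBasis i))
    rw [hi, evalAt_ι, MvPolynomial.aeval_X, b.coe_dualBasis]
  refine e.injective (MvPolynomial.funext fun x => ?_)
  have hx := h (b.equivFun.symm x)
  rw [← he] at hx
  simpa [MvPolynomial.aeval_eq_eval, Finsupp.single_apply] using hx

theorem exists_comap {m : P → W} (hm : m ∈ polynomialMaps k P W) :
    ∃ Φ : CoordRing k W →ₐ[k] CoordRing k P, ∀ p F, evalAt k p (Φ F) = evalAt k (m p) F := by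
  let b := Module.Basis.ofVectorSpace k (Module.Dual k W)
  choose G hG using fun i => exists_evalAt_eq (linearMap_comp_mem_polynomialMaps (b i) hm)
  refine ⟨SymmetricAlgebra.lift (b.constr k G), fun p => DFunLike.congr_fun
    (?_ : (evalAt k p).comp (SymmetricAlgebra.lift (b.constr k G)) = evalAt k (m p))⟩
  refine SymmetricAlgebra.algHom_ext (b.ext fun i => ?_)
  simp [hG, evalAt_ι]

theorem mem_vanishingIdeal {S : Set W} {F : CoordRing k W} :
    F ∈ vanishingIdeal k S ↔ ∀ w ∈ S, evalAt k w F = 0 := by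
  simp [vanishingIdeal]

theorem comap_surjective [Infinite k] [Module.Finite k P] {m : P → W}
    {Φ : CoordRing k W →ₐ[k] CoordRing k P} (hΦ : ∀ p F, evalAt k p (Φ F) = evalAt k (m p) F)
    (hm : ∀ d : Module.Dual k P, ∃ ξ : Module.Dual k W, ∀ p, ξ (m p) = d p) :
    Function.Surjective Φ := by
  rw [← AlgHom.range_eq_top, eq_top_iff]
  rintro G -
  induction G using SymmetricAlgebra.induction with
  | algebraMap r => exact algebraMap_mem _ r
  | ι d =>
    obtain ⟨ξ, hξ⟩ := hm d
    exact ⟨SymmetricAlgebra.ι k _ ξ, coordRing_ext fun p => (hΦ p _).trans <| by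
      rw [evalAt_ι, evalAt_ι, hξ]⟩
  | mul a b ha hb => exact mul_mem ha hb
  | add a b ha hb => exact add_mem ha hb

theorem exists_isClosedImmersion [Infinite k] [Module.Finite k P] {m : P → W}
    (hm : m ∈ polynomialMaps k P W) {S : Set W} (hS : ∀ p, m p ∈ S)
    (hd : ∀ d : Module.Dual k P, ∃ ξ : Module.Dual k W, ∀ p, ξ (m p) = d p) :
    ∃ θ : affineSpace k P ⟶ subvariety k S,
      θ ≫ subvarietyIncl k S ≫ affineSpaceStr k W = affineSpaceStr k P ∧
      (∀ p, point k p ≫ θ ≫ subvarietyIncl k S = point k (m p)) ∧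
      IsClosedImmersion θ := by
  obtain ⟨Φ, hΦ⟩ := exists_comap hm
  have hker : ∀ F ∈ vanishingIdeal k S, Φ F = 0 := fun F hF => coordRing_ext fun p => by
    rw [hΦ, map_zero, mem_vanishingIdeal.1 hF _ (hS p)]
  let Ψ := Ideal.Quotient.lift (vanishingIdeal k S) Φ.toRingHom hker
  have hθ : Spec.map (CommRingCat.ofHom Ψ) ≫ subvarietyIncl k S =
      Spec.map (CommRingCat.ofHom Φ.toRingHom) := by
    rw [subvarietyIncl, ← Spec.map_comp, ← CommRingCat.ofHom_comp,
      Ideal.Quotient.lift_comp_mk]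
  refine ⟨Spec.map (CommRingCat.ofHom Ψ), ?_, fun p => ?_,
    IsClosedImmersion.spec_of_surjective _
      (Ideal.Quotient.lift_surjective_of_surjective _ hker (comap_surjective hΦ hd))⟩
  · rw [reassoc_of% hθ, affineSpaceStr, ← Spec.map_comp, ← CommRingCat.ofHom_comp]
    exact congrArg _ (congrArg _ Φ.comp_algebraMap)
  · rw [hθ, point, ← Spec.map_comp, ← CommRingCat.ofHom_comp]
    exact congrArg _ (congrArg _ (RingHom.ext (hΦ p)))

end ClosedImmersion

section TransportedMul

open CliffordAlgebra

variable {R : Type*} [CommRing R] {M : Type*} [AddCommGroup M] [Module R M]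
  {Q Q' : QuadraticForm R M} {B : LinearMap.BilinForm R M}

theorem contractLeft_mul (d : Module.Dual R M) (x y : CliffordAlgebra Q) :
    contractLeft d (x * y) = contractLeft d x * y + involute x * contractLeft d y := by
  induction x using CliffordAlgebra.left_induction with
  | algebraMap r => simp [contractLeft_algebraMap_mul]
  | add x z hx hz => simp only [add_mul, map_add, hx, hz]; abel
  | ι_mul x m hx =>
    rw [mul_assoc, contractLeft_ι_mul, hx, contractLeft_ι_mul, map_mul, involute_ι]
    simp only [sub_mul, mul_add, smul_mul_assoc, neg_mul, mul_assoc]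
    abel

theorem involute_contractLeft (d : Module.Dual R M) (x : CliffordAlgebra Q) :
    involute (contractLeft d x) = -contractLeft d (involute x) := by
  induction x using CliffordAlgebra.left_induction with
  | algebraMap r => simp
  | add x y hx hy => simp only [map_add, hx, hy]; abel
  | ι_mul x m hx =>
    simp only [contractLeft_ι_mul, map_sub, map_smul, map_mul, involute_ι, hx, neg_mul, map_neg]
    noncomm_ring

theorem changeForm_involute (h : B.toQuadraticMap = Q' - Q) (x : CliffordAlgebra Q) :
    changeForm h (involute x) = involute (changeForm h x) := by
  induction x using CliffordAlgebra.left_induction with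
  | algebraMap r => simp [changeForm_algebraMap]
  | add x y hx hy => simp only [map_add, hx, hy]
  | ι_mul x m hx =>
    simp only [map_mul, involute_ι, neg_mul, map_neg, changeForm_ι_mul, map_sub, hx,
      involute_contractLeft]
    abel

/-- The multiplication of the Clifford algebra of `Q'`, transported to the Clifford algebra of `Q`
along `changeForm`. For `Q = 0` its restriction to the even part is `cliffordMul`. -/
def transportedMul (h : B.toQuadraticMap = Q' - Q) :
    CliffordAlgebra Q →ₗ[R] CliffordAlgebra Q →ₗ[R] CliffordAlgebra Q :=
  ((LinearMap.mul R (CliffordAlgebra Q')).compl₁₂ (changeForm h) (changeForm h)).compr₂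
    (changeForm (changeForm.neg_proof h))

variable (h : B.toQuadraticMap = Q' - Q)

theorem transportedMul_apply (x y : CliffordAlgebra Q) :
    transportedMul h x y =
      changeForm (changeForm.neg_proof h) (changeForm h x * changeForm h y) :=
  rfl

theorem transportedMul_algebraMap (r : R) (y : CliffordAlgebra Q) :
    transportedMul h (algebraMap R _ r) y = r • y := by
  rw [transportedMul_apply, changeForm_algebraMap, ← Algebra.smul_def, map_smul]
  exact congrArg _ ((changeFormEquiv h).left_inv y)

/-- The contraction terms of `changeForm_ι_mul` combine by the Leibniz rule `contractLeft_mul`. -/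
theorem transportedMul_ι_mul (a : M) (x y : CliffordAlgebra Q) :
    transportedMul h (ι Q a * x) y =
      ι Q a * transportedMul h x y + transportedMul h (involute x) (contractLeft (B a) y) := by
  have hmul : changeForm h (ι Q a * x) * changeForm h y =
      ι Q' a * (changeForm h x * changeForm h y) -
        contractLeft (B a) (changeForm h x * changeForm h y) +
        changeForm h (involute x) * changeForm h (contractLeft (B a) y) := by
    rw [changeForm_ι_mul, contractLeft_mul, changeForm_involute, changeForm_contractLeft]
    noncomm_ring
  simp only [transportedMul_apply]
  rw [hmul, map_add, map_sub, changeForm_ι_mul, changeForm_contractLeft, LinearMap.neg_apply,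
    map_neg, LinearMap.neg_apply]
  abel

theorem transportedMul_ι (a : M) (y : CliffordAlgebra Q) :
    transportedMul h (ι Q a) y = ι Q a * y + contractLeft (B a) y := by
  have h1 (z : CliffordAlgebra Q) : transportedMul h 1 z = z := by
    simpa using transportedMul_algebraMap h 1 z
  simpa [h1] using transportedMul_ι_mul h a 1 y

end TransportedMul

section Polynomiality

open CliffordAlgebra

variable {k : Type u} [Field k] {P M : Type u} [AddCommGroup P] [Module k P] [AddCommGroup M]
  [Module k M] {Q : QuadraticForm k M} {Q' : P → QuadraticForm k M}
  {β : P →ₗ[k] LinearMap.BilinForm k M}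

theorem transportedMul_apply_apply_mem_polynomialMaps [Module.Finite k P]
    (h : ∀ p, (β p).toQuadraticMap = Q' p - Q) (x y : CliffordAlgebra Q) :
    (fun p => transportedMul (h p) x y) ∈ polynomialMaps k P (CliffordAlgebra Q) := by
  let C (x : CliffordAlgebra Q) : Prop :=
    ∀ y, (fun p => transportedMul (h p) x y) ∈ polynomialMaps k P (CliffordAlgebra Q)
  have hadd (x z) (hx : C x) (hz : C z) : C (x + z) := fun y => by
    simp only [map_add, LinearMap.add_apply]
    exact add_mem (hx y) (hz y)
  have hι (a : M) (x) (hx : C x) (hx' : C (involute x)) : C (ι Q a * x) := fun y => by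
    have hc := linearMap_mem_polynomialMaps (contractLeft.flip y ∘ₗ β.flip a)
    simp only [transportedMul_ι_mul]
    exact add_mem (linearMap_comp_mem_polynomialMaps (LinearMap.mulLeft k (ι Q a)) (hx y))
      (apply_mem_polynomialMaps hx' hc)
  suffices hC : C x ∧ C (involute x) from hC.1 y
  induction x using CliffordAlgebra.left_induction with
  | algebraMap r =>
    have hr : C (algebraMap k _ r) := fun y => by
      simpa only [transportedMul_algebraMap] using const_mem_polynomialMaps (r • y)
    exact ⟨hr, by rwa [AlgHom.commutes]⟩
  | add x z hx hz => exact ⟨hadd x z hx.1 hz.1, map_add involute x z ▸ hadd _ _ hx.2 hz.2⟩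
  | ι_mul x a hx =>
    refine ⟨hι a x hx.1 hx.2, ?_⟩
    rw [map_mul, involute_ι, ← map_neg]
    exact hι (-a) _ hx.2 (by rw [involute_involute]; exact hx.1)

end Polynomiality

section Rank

variable {R : Type*} [CommRing R] [Invertible (2 : R)] {M : Type*} [AddCommGroup M] [Module R M]

/-- The basis of the Clifford algebra that corresponds to the basis of the exterior algebra formed
by the wedge products of basis vectors. -/
def cliffordBasis {ι : Type*} [LinearOrder ι] (b : Module.Basis ι R M) (Q : QuadraticForm R M) :
    Module.Basis (Finset ι) R (CliffordAlgebra Q) :=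
  b.ExteriorAlgebra.map (CliffordAlgebra.equivExterior Q).symm

variable [Nontrivial R] [Module.Free R M] [Module.Finite R M] (Q : QuadraticForm R M)

instance free_clifford : Module.Free R (CliffordAlgebra Q) :=
  .of_basis (cliffordBasis (Module.finBasis R M) Q)

instance finite_clifford : Module.Finite R (CliffordAlgebra Q) :=
  .of_basis (cliffordBasis (Module.finBasis R M) Q)

theorem finrank_clifford :
    Module.finrank R (CliffordAlgebra Q) = 2 ^ Module.finrank R M := by
  simp [Module.finrank_eq_card_basis (cliffordBasis (Module.finBasis R M) Q)]

end Rank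

section EvenProjection

open CliffordAlgebra

variable {R : Type*} [CommRing R] [Invertible (2 : R)] {M : Type*} [AddCommGroup M] [Module R M]
  {Q : QuadraticForm R M}

theorem mem_even_iff_involute_eq {x : CliffordAlgebra Q} : x ∈ even Q ↔ involute x = x := by
  refine ⟨involute_eq_of_mem_even, fun h => ?_⟩
  obtain ⟨x₀, h₀, x₁, h₁, rfl⟩ :=
    Submodule.mem_sup.1 ((evenOdd_isCompl Q).sup_eq_top ▸ Submodule.mem_top : x ∈ _)
  rw [map_add, involute_eq_of_mem_even h₀, involute_eq_of_mem_odd h₁, add_right_inj,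
    neg_eq_iff_add_eq_zero, ← two_smul R] at h
  rw [← invOf_smul_smul (2 : R) x₁, h, smul_zero, add_zero]
  exact h₀

variable (Q) in
/-- The projection of the Clifford algebra onto its even part along its odd part. -/
def evenProjection : CliffordAlgebra Q →ₗ[R] even Q :=
  LinearMap.codRestrict (Subalgebra.toSubmodule (even Q))
    (⅟(2 : R) • (LinearMap.id + involute.toLinearMap)) fun x =>
      mem_even_iff_involute_eq.2 <| by simp [add_comm]

theorem coe_evenProjection (x : CliffordAlgebra Q) :
    (evenProjection Q x : CliffordAlgebra Q) = ⅟(2 : R) • (x + involute x) :=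
  rfl

theorem evenProjection_coe (x : even Q) : evenProjection Q x = x :=
  Subtype.ext <| by
    rw [coe_evenProjection, involute_eq_of_mem_even x.2, ← two_smul R, invOf_smul_smul]

instance finite_even [Module.Finite R (CliffordAlgebra Q)] : Module.Finite R (even Q) :=
  .of_surjective (evenProjection Q) fun x => ⟨x, evenProjection_coe x⟩

instance free_even [IsDomain R] [IsPrincipalIdealRing R] [Module.Finite R (CliffordAlgebra Q)]
    [Module.Free R (CliffordAlgebra Q)] : Module.Free R (even Q) :=
  inferInstanceAs (Module.Free R (Subalgebra.toSubmodule (even Q)))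

end EvenProjection

section EvenFunctoriality

open CliffordAlgebra

variable {R : Type*} [CommRing R] {M₁ M₂ : Type*} [AddCommGroup M₁] [Module R M₁]
  [AddCommGroup M₂] [Module R M₂] {Q₁ : QuadraticForm R M₁} {Q₂ : QuadraticForm R M₂}

/-- The homomorphism of even Clifford algebras induced by an isometry. -/
def evenMap (f : Q₁ →qᵢ Q₂) : even Q₁ →ₐ[R] even Q₂ :=
  even.lift Q₁
    { bilin := (even.ι Q₂).bilin.compl₁₂ f.toLinearMap f.toLinearMap
      contract := fun m => by simpa using (even.ι Q₂).contract (f m)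
      contract_mid := fun m₁ m₂ m₃ => by
        simpa using (even.ι Q₂).contract_mid (f m₁) (f m₂) (f m₃) }

theorem evenMap_ι (f : Q₁ →qᵢ Q₂) (a b : M₁) :
    evenMap f ((even.ι Q₁).bilin a b) = (even.ι Q₂).bilin (f a) (f b) :=
  even.lift_ι ..

/-- The isomorphism of even Clifford algebras induced by an isometry equivalence. -/
def evenEquivOfIsometry (e : Q₁.IsometryEquiv Q₂) : even Q₁ ≃ₐ[R] even Q₂ :=
  AlgEquiv.ofAlgHom (evenMap e.toIsometry) (evenMap e.symm.toIsometry)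
    (even.algHom_ext Q₂ <| by ext a b; simp [evenMap_ι])
    (even.algHom_ext Q₁ <| by ext a b; simp [evenMap_ι])

end EvenFunctoriality

section EvenBaseChange

open CliffordAlgebra

variable {R : Type*} [CommRing R] [Invertible (2 : R)] {M : Type*} [AddCommGroup M] [Module R M]
  (S : Type*) [CommRing S] [Algebra R S] (Q : QuadraticForm R M)

theorem ofBaseChange_mem_even_iff {z : S ⊗[R] CliffordAlgebra Q} :
    ofBaseChange S Q z ∈ even (Q.baseChange S) ↔ involute.toLinearMap.lTensor S z = z := by
  let _ : Invertible (2 : S) := (Invertible.map (algebraMap R S) 2).copy 2 (map_ofNat _ _).symm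
  rw [mem_even_iff_involute_eq, ← (equivBaseChange S Q).injective.eq_iff]
  change toBaseChange S Q _ = toBaseChange S Q _ ↔ _
  rw [toBaseChange_involute, toBaseChange_ofBaseChange]
  rfl

theorem lTensor_evenProjection (z : S ⊗[R] CliffordAlgebra Q) :
    (even Q).val.toLinearMap.lTensor S ((evenProjection Q).lTensor S z) =
      ⅟(2 : R) • (z + involute.toLinearMap.lTensor S z) := by
  have h : (even Q).val.toLinearMap ∘ₗ evenProjection Q =
      ⅟(2 : R) • (LinearMap.id + involute.toLinearMap) := rfl
  rw [← LinearMap.lTensor_comp_apply, h]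
  simp [LinearMap.lTensor_add]

/-- The comparison map from the base change of the even Clifford algebra to the even Clifford
algebra of the base change. -/
def evenBaseChangeHom : S ⊗[R] even Q →ₐ[S] even (Q.baseChange S) :=
  ((ofBaseChange S Q).comp
    (Algebra.TensorProduct.map (AlgHom.id S S) (even Q).val)).codRestrict _ fun z =>
      (ofBaseChange_mem_even_iff S Q).2 <| by
        change involute.toLinearMap.lTensor S ((even Q).val.toLinearMap.lTensor S z) =
          (even Q).val.toLinearMap.lTensor S z
        rw [← LinearMap.lTensor_comp_apply]
        congr 2
        ext x
        exact involute_eq_of_mem_even x.2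

theorem coe_evenBaseChangeHom (z : S ⊗[R] even Q) :
    (evenBaseChangeHom S Q z : CliffordAlgebra (Q.baseChange S)) =
      ofBaseChange S Q ((even Q).val.toLinearMap.lTensor S z) :=
  rfl

theorem evenBaseChangeHom_injective : Function.Injective (evenBaseChangeHom S Q) := by
  have hleft : Function.LeftInverse ((evenProjection Q).lTensor S)
      ((even Q).val.toLinearMap.lTensor S) := fun z => by
    have h : evenProjection Q ∘ₗ (even Q).val.toLinearMap = LinearMap.id :=
      LinearMap.ext evenProjection_coe
    rw [← LinearMap.lTensor_comp_apply, h, LinearMap.lTensor_id, LinearMap.id_apply]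
  exact .of_comp (f := Subtype.val) <| (equivBaseChange S Q).symm.injective.comp hleft.injective

theorem evenBaseChangeHom_surjective : Function.Surjective (evenBaseChangeHom S Q) := by
  intro y
  obtain ⟨z, hz⟩ := (equivBaseChange S Q).symm.surjective y
  have hz' : involute.toLinearMap.lTensor S z = z :=
    (ofBaseChange_mem_even_iff S Q).1 (by rw [show ofBaseChange S Q z = y from hz]; exact y.2)
  refine ⟨(evenProjection Q).lTensor S z, Subtype.ext ?_⟩
  rw [coe_evenBaseChangeHom, lTensor_evenProjection, hz', ← two_smul R, invOf_smul_smul]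
  exact hz

/-- The even Clifford algebra commutes with base change. -/
def evenBaseChange : S ⊗[R] even Q ≃ₐ[S] even (Q.baseChange S) :=
  AlgEquiv.ofBijective (evenBaseChangeHom S Q)
    ⟨evenBaseChangeHom_injective S Q, evenBaseChangeHom_surjective S Q⟩

variable {ι : Type*} [Fintype ι] [DecidableEq ι]

/-- The base change of a diagonal quadratic form is the diagonal form with the same weights. -/
def weightedSumSquaresBaseChange (w : ι → R) :
    (QuadraticForm.baseChange S (QuadraticMap.weightedSumSquares R w)).IsometryEquiv
      (QuadraticMap.weightedSumSquares S fun i => algebraMap R S (w i)) where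
  toLinearEquiv := TensorProduct.piScalarRight R S S ι
  map_app' := DFunLike.congr_fun (f := QuadraticMap.comp _ _) <| baseChange_ext fun m => by
    simp [QuadraticForm.baseChange_tmul, QuadraticMap.weightedSumSquares_apply, Algebra.smul_def]

/-- The even Clifford algebra of a diagonal quadratic form commutes with base change. -/
def evenWeightedSumSquaresBaseChange (w : ι → R) :
    S ⊗[R] even (QuadraticMap.weightedSumSquares R w) ≃ₐ[S]
      even (QuadraticMap.weightedSumSquares S fun i => algebraMap R S (w i)) :=
  (evenBaseChange S _).trans (evenEquivOfIsometry (weightedSumSquaresBaseChange S w))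

end EvenBaseChange

section Nondegenerate

variable {R : Type*} [CommRing R] [Invertible (2 : R)] {M₁ M₂ : Type*} [AddCommGroup M₁]
  [Module R M₁] [AddCommGroup M₂] [Module R M₂]

theorem nondegenerate_iff_polar {Q : QuadraticForm R M₁} :
    Q.Nondegenerate ↔ ∀ x, (∀ y, QuadraticMap.polar Q x y = 0) → x = 0 := by
  rw [QuadraticMap.nondegenerate_iff_radical_eq_bot, QuadraticMap.radical_eq_ker_polarBilin,
    LinearMap.ker_eq_bot']
  simp [LinearMap.ext_iff]

theorem nondegenerate_prod {Q₁ : QuadraticForm R M₁} {Q₂ : QuadraticForm R M₂}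
    (h₁ : Q₁.Nondegenerate) (h₂ : Q₂.Nondegenerate) : (Q₁.prod Q₂).Nondegenerate := by
  rw [nondegenerate_iff_polar] at *
  exact fun x hx => Prod.ext (h₁ _ fun y => by simpa using hx (y, 0))
    (h₂ _ fun y => by simpa using hx (0, y))

theorem nondegenerate_neg_sq : (-QuadraticMap.sq : QuadraticForm R R).Nondegenerate :=
  nondegenerate_iff_polar.2 fun x hx => by
    have h : -((x + 1) * (x + 1)) + x * x + 1 = 0 := by simpa [QuadraticMap.polar] using hx 1
    linear_combination -⅟(2 : R) * h - x * invOf_mul_self (2 : R)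

/-- The hyperbolic plane: the quadratic form `(x, y) ↦ x * y`. -/
def hyperbolicPlane (R : Type*) [CommRing R] : QuadraticForm R (R × R) :=
  QuadraticMap.linMulLin (LinearMap.fst R R R) (LinearMap.snd R R R)

theorem nondegenerate_hyperbolicPlane : (hyperbolicPlane R).Nondegenerate :=
  nondegenerate_iff_polar.2 fun x hx => Prod.ext
    (by simpa [hyperbolicPlane, QuadraticMap.polar, mul_add] using hx (0, 1))
    (by simpa [hyperbolicPlane, QuadraticMap.polar, add_mul] using hx (1, 0))

theorem equivalent_of_nondegenerate {F E₁ E₂ : Type*} [Field F] [IsAlgClosed F]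
    [Invertible (2 : F)] [AddCommGroup E₁] [Module F E₁] [Module.Finite F E₁] [AddCommGroup E₂]
    [Module F E₂] [Module.Finite F E₂] {Q₁ : QuadraticForm F E₁} {Q₂ : QuadraticForm F E₂}
    (h₁ : Q₁.Nondegenerate) (h₂ : Q₂.Nondegenerate)
    (h : Module.finrank F E₁ = Module.finrank F E₂) : Q₁.Equivalent Q₂ := by
  have e₁ := Q₁.equivalent_weightedSumSquares_of_isAlgClosed
    (QuadraticMap.nondegenerate_associated_iff.2 h₁).1
  have e₂ := Q₂.equivalent_weightedSumSquares_of_isAlgClosed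
    (QuadraticMap.nondegenerate_associated_iff.2 h₂).1
  rw [h] at e₁
  exact e₁.trans e₂.symm

theorem nondegenerate_weightedSumSquares {F ι : Type*} [Field F] [Invertible (2 : F)] [Fintype ι]
    {w : ι → F} (hw : ∀ i, w i ≠ 0) : (QuadraticMap.weightedSumSquares F w).Nondegenerate := by
  have : NeZero (2 : F) := ⟨Invertible.ne_zero 2⟩
  rw [QuadraticMap.nondegenerate_iff_radical_eq_bot, QuadraticForm.radical_weightedSumSquares]
  simp [hw, Pi.spanSubset]

end Nondegenerate

section HyperbolicPlane

variable {R : Type*} [CommRing R] {M : Type*} [AddCommGroup M] [Module R M]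
  (Q : QuadraticForm R M)

/-- The representation of the Clifford algebra of the orthogonal sum of `Q` and a hyperbolic plane
by `2 × 2` matrices over the Clifford algebra of `Q`. -/
def cliffordProdHyperbolicHom :
    CliffordAlgebra (Q.prod (hyperbolicPlane R)) →ₐ[R]
      Matrix (Fin 2) (Fin 2) (CliffordAlgebra Q) :=
  CliffordAlgebra.lift _
    ⟨{ toFun := fun v => !![CliffordAlgebra.ι Q v.1, algebraMap R _ v.2.1;
          algebraMap R _ v.2.2, -CliffordAlgebra.ι Q v.1]
       map_add' := fun v w => by
        ext i j
        fin_cases i <;> fin_cases j <;> simp [add_comm]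
       map_smul' := fun r v => by
        ext i j
        fin_cases i <;> fin_cases j <;> simp [Algebra.smul_def] },
     fun v => by
      ext i j
      fin_cases i <;> fin_cases j <;>
        simp [hyperbolicPlane, Algebra.algebraMap_eq_smul_one, add_smul, mul_smul, add_comm,
          smul_comm v.2.1 v.2.2]⟩

theorem cliffordProdHyperbolicHom_ι (v : M × R × R) :
    cliffordProdHyperbolicHom Q (CliffordAlgebra.ι _ v) =
      !![CliffordAlgebra.ι Q v.1, algebraMap R _ v.2.1;
        algebraMap R _ v.2.2, -CliffordAlgebra.ι Q v.1] :=
  CliffordAlgebra.lift_ι_apply _ _ _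

theorem cliffordProdHyperbolicHom_surjective :
    Function.Surjective (cliffordProdHyperbolicHom Q) := by
  rw [← AlgHom.range_eq_top, eq_top_iff]
  set A := (cliffordProdHyperbolicHom Q).range
  have hX : !![0, 1; 0, 0] ∈ A :=
    ⟨CliffordAlgebra.ι _ (0, 1, 0), by simp [cliffordProdHyperbolicHom_ι]⟩
  have hY : !![0, 0; 1, 0] ∈ A :=
    ⟨CliffordAlgebra.ι _ (0, 0, 1), by simp [cliffordProdHyperbolicHom_ι]⟩
  have hD (c : CliffordAlgebra Q) : !![c, 0; 0, c] ∈ A := by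
    induction c using CliffordAlgebra.induction with
    | algebraMap r =>
      convert algebraMap_mem A r using 1
      ext i j
      fin_cases i <;> fin_cases j <;> simp [Matrix.algebraMap_matrix_apply]
    | ι v =>
      have hv : !![CliffordAlgebra.ι Q v, 0; 0, -CliffordAlgebra.ι Q v] ∈ A :=
        ⟨CliffordAlgebra.ι _ (v, 0, 0), by simp [cliffordProdHyperbolicHom_ι]⟩
      convert mul_mem hv (sub_mem (mul_mem hX hY) (mul_mem hY hX)) using 1
      simp
    | mul a b ha hb =>
      convert mul_mem ha hb using 1
      simp
    | add a b ha hb =>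
      convert add_mem ha hb using 1
      simp
  intro m _
  convert add_mem (add_mem (mul_mem (hD (m 0 0)) (mul_mem hX hY)) (mul_mem (hD (m 0 1)) hX))
    (add_mem (mul_mem (hD (m 1 0)) hY) (mul_mem (hD (m 1 1)) (mul_mem hY hX))) using 1
  ext i j
  fin_cases i <;> fin_cases j <;> simp

/-- The Clifford algebra of the orthogonal sum of `Q` and a hyperbolic plane is the algebra of
`2 × 2` matrices over the Clifford algebra of `Q`. -/
def cliffordProdHyperbolicEquiv [Invertible (2 : R)] [Nontrivial R] [Module.Free R M]
    [Module.Finite R M] :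
    CliffordAlgebra (Q.prod (hyperbolicPlane R)) ≃ₐ[R]
      Matrix (Fin 2) (Fin 2) (CliffordAlgebra Q) :=
  AlgEquiv.ofBijective (cliffordProdHyperbolicHom Q) <|
    OrzechProperty.bijective_of_surjective_of_finrank_le (cliffordProdHyperbolicHom Q).toLinearMap
      (cliffordProdHyperbolicHom_surjective Q) <| by
        rw [finrank_clifford, Module.finrank_matrix, finrank_clifford]
        simp [pow_add, mul_comm]

end HyperbolicPlane

section MatrixAlgebra

variable {F E : Type u} [Field F] [IsAlgClosed F] [Invertible (2 : F)]
  [AddCommGroup E] [Module F E] [Module.Finite F E] {Q : QuadraticForm F E}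

theorem nonempty_clifford_algEquiv_matrix (hQ : Q.Nondegenerate) {ℓ : ℕ}
    (hE : Module.finrank F E = 2 * ℓ) :
    Nonempty (CliffordAlgebra Q ≃ₐ[F] Matrix (Fin (2 ^ ℓ)) (Fin (2 ^ ℓ)) F) := by
  induction ℓ generalizing E with
  | zero =>
    have hC : Module.finrank F (CliffordAlgebra Q) = 1 := by simp [finrank_clifford, hE]
    have hF : Module.finrank F (Matrix (Fin (2 ^ 0)) (Fin (2 ^ 0)) F) = 1 := by
      simp [Module.finrank_matrix]
    rw [Algebra.finrank_eq_one_iff_bijective_algebraMap] at hC hF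
    exact ⟨(AlgEquiv.ofBijective (Algebra.ofId F _) hC).symm.trans
      (AlgEquiv.ofBijective (Algebra.ofId F _) hF)⟩
  | succ ℓ ih =>
    let Q₀ := QuadraticMap.weightedSumSquares F (1 : Fin (2 * ℓ) → F)
    have hQ₀ : Q₀.Nondegenerate := nondegenerate_weightedSumSquares fun _ => one_ne_zero
    obtain ⟨e⟩ := ih hQ₀ (by simp)
    obtain ⟨f⟩ := equivalent_of_nondegenerate hQ
      (nondegenerate_prod hQ₀ nondegenerate_hyperbolicPlane) (by simp [hE]; ring)
    exact ⟨(CliffordAlgebra.equivOfIsometry f).trans <| (cliffordProdHyperbolicEquiv Q₀).trans <|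
      e.mapMatrix.trans <| (Matrix.compAlgEquiv _ _ _ _).trans <| Matrix.reindexAlgEquiv _ _ <|
        finProdFinEquiv.trans <| finCongr (pow_succ' 2 ℓ).symm⟩

theorem nonempty_even_algEquiv_matrix (hQ : Q.Nondegenerate) {ℓ : ℕ}
    (hE : Module.finrank F E = 2 * ℓ + 1) :
    Nonempty (CliffordAlgebra.even Q ≃ₐ[F] Matrix (Fin (2 ^ ℓ)) (Fin (2 ^ ℓ)) F) := by
  let Q₀ := QuadraticMap.weightedSumSquares F (1 : Fin (2 * ℓ) → F)
  have hQ₀ : Q₀.Nondegenerate := nondegenerate_weightedSumSquares fun _ => one_ne_zero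
  obtain ⟨e⟩ := nonempty_clifford_algEquiv_matrix (ℓ := ℓ) hQ₀ (by simp)
  obtain ⟨f⟩ := equivalent_of_nondegenerate hQ (nondegenerate_prod hQ₀ nondegenerate_neg_sq)
    (by simp [hE])
  exact ⟨(evenEquivOfIsometry f).trans ((CliffordAlgebra.equivEven Q₀).symm.trans e)⟩

end MatrixAlgebra

section Specialisation

variable {k : Type u} [Field k]

theorem isSpecialisation_of_fibres {R : Type u} [CommRing R] [IsDomain R]
    [IsDiscreteValuationRing R] [Algebra k R]
    (hR : Function.Bijective (algebraMap k (IsLocalRing.ResidueField R)))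
    {A : Type u} [Ring A] [Algebra R A] [Module.Free R A] {n : ℕ}
    (generic : Nonempty (AlgebraicClosure (FractionRing R) ⊗[R] A
      ≃ₐ[AlgebraicClosure (FractionRing R)]
        Matrix (Fin n) (Fin n) (AlgebraicClosure (FractionRing R))))
    {A₀ : Type u} [Ring A₀] [Algebra k A₀]
    (special : Nonempty (IsLocalRing.ResidueField R ⊗[R] A ≃ₐ[k] A₀)) :
    IsSpecialisation k n A₀ := by
  refine ⟨?_, R, inferInstance, inferInstance, inferInstance, inferInstance, A, inferInstance,
    inferInstance, hR, inferInstance, generic, special⟩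
  obtain ⟨e⟩ := generic
  obtain ⟨f⟩ := special
  have hA : Module.finrank R A = n ^ 2 := by
    rw [← Module.finrank_baseChange (R := AlgebraicClosure (FractionRing R)),
      e.toLinearEquiv.finrank_eq, Module.finrank_matrix]
    simp [sq]
  rw [← f.toLinearEquiv.finrank_eq,
    ← Module.finrank_mul_finrank k (IsLocalRing.ResidueField R) (IsLocalRing.ResidueField R ⊗[R] A),
    Algebra.finrank_eq_one_iff_bijective_algebraMap.2 hR, Module.finrank_baseChange, hA, one_mul]

end Specialisation

section PowerSeriesFibres

variable {k : Type u} [Field k]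

theorem residue_powerSeries (f : PowerSeries k) :
    IsLocalRing.residue (PowerSeries k) f =
      algebraMap k (IsLocalRing.ResidueField (PowerSeries k)) (PowerSeries.constantCoeff f) := by
  rw [IsScalarTower.algebraMap_apply k (PowerSeries k)]
  change _ = IsLocalRing.residue _ _
  rw [← sub_eq_zero, ← map_sub, IsLocalRing.residue_eq_zero_iff,
    ← PowerSeries.ker_coeff_eq_max_ideal]
  simp [RingHom.mem_ker]

theorem bijective_algebraMap_residueField_powerSeries :
    Function.Bijective (algebraMap k (IsLocalRing.ResidueField (PowerSeries k))) :=
  ⟨RingHom.injective _, fun y => by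
    obtain ⟨f, rfl⟩ := IsLocalRing.residue_surjective y
    exact ⟨_, (residue_powerSeries f).symm⟩⟩

theorem nonempty_genericFibre_even_algEquiv_matrix {R : Type u} [CommRing R] [IsDomain R]
    [Invertible (2 : R)] {ℓ : ℕ} {w : Fin (2 * ℓ + 1) → R} (hw : ∀ i, w i ≠ 0) :
    Nonempty (AlgebraicClosure (FractionRing R) ⊗[R]
      CliffordAlgebra.even (QuadraticMap.weightedSumSquares R w)
        ≃ₐ[AlgebraicClosure (FractionRing R)]
          Matrix (Fin (2 ^ ℓ)) (Fin (2 ^ ℓ)) (AlgebraicClosure (FractionRing R))) := by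
  let L := AlgebraicClosure (FractionRing R)
  have hL : Function.Injective (algebraMap R L) := by
    rw [IsScalarTower.algebraMap_eq R (FractionRing R) L]
    exact (algebraMap (FractionRing R) L).injective.comp (IsFractionRing.injective R _)
  have : Invertible (2 : L) :=
    (Invertible.map (algebraMap R L) 2).copy 2 (map_ofNat _ _).symm
  obtain ⟨e⟩ := nonempty_even_algEquiv_matrix (ℓ := ℓ)
    (nondegenerate_weightedSumSquares (F := L) fun i => (map_ne_zero_iff _ hL).2 (hw i)) (by simp)
  exact ⟨(evenWeightedSumSquaresBaseChange L w).trans e⟩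

theorem nonempty_specialFibre_even_algEquiv [Invertible (2 : k)] [Invertible (2 : PowerSeries k)]
    {ι : Type*} [Fintype ι] {w : ι → PowerSeries k} {w₀ : ι → k}
    (hw : ∀ i, PowerSeries.constantCoeff (w i) = w₀ i) :
    Nonempty (IsLocalRing.ResidueField (PowerSeries k) ⊗[PowerSeries k]
      CliffordAlgebra.even (QuadraticMap.weightedSumSquares (PowerSeries k) w) ≃ₐ[k]
        CliffordAlgebra.even (QuadraticMap.weightedSumSquares k w₀)) := by
  classical
  let κ := IsLocalRing.ResidueField (PowerSeries k)
  have e₁ := evenWeightedSumSquaresBaseChange κ w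
  have hκ : (fun i => algebraMap (PowerSeries k) κ (w i)) = fun i => algebraMap k κ (w₀ i) :=
    funext fun i => hw i ▸ residue_powerSeries (w i)
  rw [hκ] at e₁
  have e₂ := e₁.trans (evenWeightedSumSquaresBaseChange κ w₀).symm
  let f : k ≃ₐ[k] κ := .ofBijective (Algebra.ofId k κ)
    bijective_algebraMap_residueField_powerSeries
  exact ⟨(e₂.restrictScalars k).trans <|
    (Algebra.TensorProduct.congr f.symm .refl).trans (Algebra.TensorProduct.lid k _)⟩

end PowerSeriesFibres

section SpecialisationOfEven

variable {k : Type u} [Field k] [Invertible (2 : k)] {M : Type u} [AddCommGroup M]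
  [Module k M]

theorem isSpecialisation_even_weightedSumSquares {ℓ : ℕ} (w : Fin (2 * ℓ + 1) → k) :
    IsSpecialisation k (2 ^ ℓ)
      (CliffordAlgebra.even (QuadraticMap.weightedSumSquares k w)) := by
  have : Invertible (2 : PowerSeries k) :=
    (Invertible.map (algebraMap k (PowerSeries k)) 2).copy 2 (map_ofNat _ _).symm
  let W (i : Fin (2 * ℓ + 1)) : PowerSeries k := PowerSeries.C (w i) + PowerSeries.X
  have hW (i) : W i ≠ 0 := fun h => by
    simpa [W] using congrArg (PowerSeries.coeff 1) h
  refine isSpecialisation_of_fibres bijective_algebraMap_residueField_powerSeries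
    (nonempty_genericFibre_even_algEquiv_matrix hW)
    (nonempty_specialFibre_even_algEquiv (w := W) fun i => ?_)
  simp [W]

theorem isSpecialisation_even [Module.Finite k M] {ℓ : ℕ} (hM : Module.finrank k M = 2 * ℓ + 1)
    (q : QuadraticForm k M) : IsSpecialisation k (2 ^ ℓ) (CliffordAlgebra.even q) := by
  obtain ⟨w, ⟨e⟩⟩ := hM ▸ q.equivalent_weightedSumSquares
  obtain ⟨-, R, _, _, _, _, A, _, _, hR, _, generic, ⟨f⟩⟩ :=
    isSpecialisation_even_weightedSumSquares w
  exact isSpecialisation_of_fibres hR generic ⟨f.trans (evenEquivOfIsometry e).symm⟩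

end SpecialisationOfEven

section CliffordMul

open CliffordAlgebra

variable {k : Type u} [Field k] {M : Type u} [AddCommGroup M] [Module k M]

theorem evenIso_one (q : QuadraticForm k M) (B : LinearMap.BilinForm k M)
    (h : B.toQuadraticMap = q) : evenIso q B h 1 = 1 :=
  Subtype.ext (changeForm_one (by rw [h, sub_zero]))

theorem evenIso_cliffordMul (q : QuadraticForm k M) (B : LinearMap.BilinForm k M)
    (h : B.toQuadraticMap = q) (x y : EvenExterior k M) :
    evenIso q B h (cliffordMul q B h x y) = evenIso q B h x * evenIso q B h y := by
  simp [cliffordMul]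

theorem cliffordMul_mem_specialisations [Invertible (2 : k)] [Module.Finite k M]
    {ℓ : ℕ} (hM : Module.finrank k M = 2 * ℓ + 1) (q : QuadraticForm k M)
    (B : LinearMap.BilinForm k M) (h : B.toQuadraticMap = q) :
    cliffordMul q B h ∈ specialisations k (2 ^ ℓ) (1 : EvenExterior k M) :=
  ⟨even q, inferInstance, inferInstance, evenIso q B h, evenIso_one q B h,
    evenIso_cliffordMul q B h, isSpecialisation_even hM q⟩

end CliffordMul

section QuadraticForms

variable {k : Type u} [Field k] {M : Type u} [AddCommGroup M] [Module k M]

theorem finite_quadraticForm [Module.Finite k M]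
    {β : QuadraticForm k M →ₗ[k] LinearMap.BilinForm k M}
    (hβ : ∀ q, (β q).toQuadraticMap = q) : Module.Finite k (QuadraticForm k M) :=
  .of_injective β fun q q' h => by rw [← hβ q, h, hβ q']

variable (k) in
/-- Evaluation of quadratic forms at the vector `a`, as a linear functional. -/
def quadraticFormEval (a : M) : Module.Dual k (QuadraticForm k M) where
  toFun q := q a
  map_add' _ _ := rfl
  map_smul' _ _ := rfl

theorem span_range_quadraticFormEval [Module.Finite k (QuadraticForm k M)] :
    Submodule.span k (Set.range (quadraticFormEval (M := M) k)) = ⊤ :=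
  Submodule.span_eq_top_of_ne_zero fun q hq => by
    contrapose! hq
    ext a
    exact hq _ ⟨a, rfl⟩

end QuadraticForms

section Polynomiality

variable {k : Type u} [Field k] {M : Type u} [AddCommGroup M] [Module k M]

theorem coe_cliffordMul (q : QuadraticForm k M) (B : LinearMap.BilinForm k M)
    (h : B.toQuadraticMap = q) (x y : EvenExterior k M) :
    (cliffordMul q B h x y : CliffordAlgebra (0 : QuadraticForm k M)) =
      transportedMul (h.trans (sub_zero q).symm) x.1 y.1 :=
  rfl

theorem cliffordMul_mem_polynomialMaps [Invertible (2 : k)] [Module.Finite k M]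
    [Module.Finite k (QuadraticForm k M)] {β : QuadraticForm k M →ₗ[k] LinearMap.BilinForm k M}
    (hβ : ∀ q, (β q).toQuadraticMap = q) :
    (fun q => cliffordMul q (β q) (hβ q)) ∈ polynomialMaps k (QuadraticForm k M)
      (EvenExterior k M →ₗ[k] EvenExterior k M →ₗ[k] EvenExterior k M) := by
  refine mem_polynomialMaps_of_apply fun x => mem_polynomialMaps_of_apply fun y => ?_
  have h := linearMap_comp_mem_polynomialMaps (evenProjection 0) <|
    transportedMul_apply_apply_mem_polynomialMaps (fun q => (hβ q).trans (sub_zero q).symm) x.1 y.1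
  simpa only [← coe_cliffordMul _ _ (hβ _), evenProjection_coe] using h

end Polynomiality

section Recovery

open CliffordAlgebra

variable {k : Type u} [Field k] {M : Type u} [AddCommGroup M] [Module k M]

/-- The wedge product of two vectors, as an element of the even exterior algebra. -/
def wedge (a b : M) : EvenExterior k M := (even.ι (0 : QuadraticForm k M)).bilin a b

theorem coe_wedge (a b : M) :
    ((wedge a b : EvenExterior k M) : CliffordAlgebra (0 : QuadraticForm k M)) = ι 0 a * ι 0 b :=
  rfl

theorem cliffordMul_wedge_wedge (q : QuadraticForm k M) (B : LinearMap.BilinForm k M)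
    (h : B.toQuadraticMap = q) (a b c : M) :
    cliffordMul q B h (wedge a b) (wedge a c) =
      B b a • wedge a c - q a • wedge b c - B a c • wedge a b +
        algebraMap k _ (B b a * B a c - q a * B b c) := by
  have haa : B a a = q a := by rw [← h, LinearMap.BilinMap.toQuadraticMap_apply]
  have hba : ι (0 : QuadraticForm k M) b * ι 0 a = -(ι 0 a * ι 0 b) := by
    rw [ι_mul_ι_comm]
    simp [QuadraticMap.polar]
  have haba (x) : ι (0 : QuadraticForm k M) a * (ι 0 b * (ι 0 a * x)) = 0 := by
    rw [← mul_assoc (ι 0 b), hba, neg_mul, mul_neg, mul_assoc, ← mul_assoc, ι_sq_scalar]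
    simp
  refine Subtype.ext ?_
  rw [coe_cliffordMul, coe_wedge, coe_wedge, transportedMul_ι_mul, transportedMul_ι, involute_ι,
    map_neg, LinearMap.neg_apply]
  simp only [contractLeft_ι_mul, contractLeft_ι, Algebra.algebraMap_eq_smul_one, mul_smul_comm,
    mul_one, mul_add, mul_sub, haba, ι_sq_scalar, zero_apply, zero_smul, smul_zero,
    sub_zero, zero_add, haa, transportedMul_ι, hba, map_sub, map_smul,
    neg_sub, Subalgebra.coe_add, Subalgebra.coe_sub, Subalgebra.coe_smul, coe_wedge,
    Subalgebra.coe_one]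
  module

/-- The functional on the even exterior algebra given by contraction with `d` and `d'`. -/
def contractTwo (d d' : Module.Dual k M) : Module.Dual k (EvenExterior k M) :=
  ExteriorAlgebra.algebraMapInv.toLinearMap ∘ₗ contractLeft d' ∘ₗ contractLeft d ∘ₗ
    (even (0 : QuadraticForm k M)).val.toLinearMap

theorem contractTwo_apply (d d' : Module.Dual k M) (x : EvenExterior k M) :
    contractTwo d d' x = ExteriorAlgebra.algebraMapInv (contractLeft d' (contractLeft d x.1)) :=
  rfl

theorem contractTwo_algebraMap (d d' : Module.Dual k M) (r : k) :
    contractTwo d d' (algebraMap k _ r) = 0 := by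
  simp [contractTwo_apply]

theorem contractTwo_wedge (d d' : Module.Dual k M) (a b : M) :
    contractTwo d d' (wedge a b) = d a * d' b - d b * d' a := by
  have h (r : k) : ExteriorAlgebra.algebraMapInv
      (algebraMap k (CliffordAlgebra (0 : QuadraticForm k M)) r) = r :=
    ExteriorAlgebra.algebraMap_leftInverse M r
  rw [contractTwo_apply, coe_wedge, contractLeft_ι_mul, contractLeft_ι, map_sub, map_smul,
    contractLeft_ι, contractLeft_mul_algebraMap, contractLeft_ι, map_sub, map_smul, ← map_mul, h, h,
    smul_eq_mul, mul_comm (d' a)]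

theorem exists_dual_family {ι : Type*} [DecidableEq ι] {v : ι → M} (hv : LinearIndependent k v) :
    ∃ d : ι → Module.Dual k M, ∀ i j, d i (v j) = if j = i then 1 else 0 := by
  obtain ⟨g, hg⟩ := LinearMap.exists_leftInverse_of_injective _ (LinearMap.ker_eq_bot.2 hv)
  refine ⟨fun i => Finsupp.lapply i ∘ₗ g, fun i j => ?_⟩
  have hj : g (v j) = Finsupp.single j 1 := by
    simpa using LinearMap.congr_fun hg (Finsupp.single j 1)
  simp [hj, Finsupp.single_apply]

theorem exists_dual_cliffordMul_eq_apply (hM : 3 ≤ Module.finrank k M) (a : M) :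
    ∃ ξ : Module.Dual k (EvenExterior k M →ₗ[k] EvenExterior k M →ₗ[k] EvenExterior k M),
      ∀ (q : QuadraticForm k M) (B : LinearMap.BilinForm k M) (h : B.toQuadraticMap = q),
        ξ (cliffordMul q B h) = q a := by
  rcases eq_or_ne a 0 with rfl | ha
  · exact ⟨0, fun q _ _ => by simp⟩
  obtain ⟨b, hab⟩ := exists_linearIndependent_pair_of_one_lt_finrank (R := k) (by omega) ha
  obtain ⟨c, hcab⟩ := exists_linearIndependent_cons_of_lt_finrank hab (by omega)
  obtain ⟨d, hd⟩ := exists_dual_family hcab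
  have hda (i) : d i a = if 1 = i then 1 else 0 := hd i 1
  have hdb (i) : d i b = if 2 = i then 1 else 0 := hd i 2
  have hdc (i) : d i c = if 0 = i then 1 else 0 := hd i 0
  refine ⟨-(contractTwo (d 2) (d 0) ∘ₗ LinearMap.applyₗ (wedge a c) ∘ₗ
    LinearMap.applyₗ (wedge a b)), fun q B h => ?_⟩
  change -contractTwo (d 2) (d 0) (cliffordMul q B h (wedge a b) (wedge a c)) = q a
  rw [cliffordMul_wedge_wedge, map_add, contractTwo_algebraMap]
  simp [contractTwo_wedge, hda, hdb, hdc]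

theorem exists_dual_cliffordMul_eq [Module.Finite k (QuadraticForm k M)]
    (hM : 3 ≤ Module.finrank k M) {β : QuadraticForm k M → LinearMap.BilinForm k M}
    (hβ : ∀ q, (β q).toQuadraticMap = q) (d : Module.Dual k (QuadraticForm k M)) :
    ∃ ξ : Module.Dual k (EvenExterior k M →ₗ[k] EvenExterior k M →ₗ[k] EvenExterior k M),
      ∀ q, ξ (cliffordMul q (β q) (hβ q)) = d q := by
  have hd := span_range_quadraticFormEval (k := k) (M := M) ▸ Submodule.mem_top (x := d)
  induction hd using Submodule.span_induction with
  | mem d hd =>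
    obtain ⟨a, rfl⟩ := hd
    obtain ⟨ξ, hξ⟩ := exists_dual_cliffordMul_eq_apply hM a
    exact ⟨ξ, fun q => hξ q _ (hβ q)⟩
  | zero => exact ⟨0, fun q => rfl⟩
  | add d d' _ _ hd hd' =>
    obtain ⟨ξ, hξ⟩ := hd
    obtain ⟨η, hη⟩ := hd'
    exact ⟨ξ + η, fun q => by simp [hξ, hη]⟩
  | smul c d _ hd =>
    obtain ⟨ξ, hξ⟩ := hd
    exact ⟨c • ξ, fun q => by simp [hξ]⟩

end Recovery

end

end CliffordSpecialisation

open CliffordSpecialisation in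
theorem proposition3p1_general {k : Type u} [Field k] [Infinite k] (h2 : (2 : k) ≠ 0)
    {M : Type u} [AddCommGroup M] [Module k M] (ℓ : ℕ) (hℓ : 1 ≤ ℓ)
    (hM : Module.finrank k M = 2 * ℓ + 1)
    (β : QuadraticForm k M →ₗ[k] LinearMap.BilinForm k M)
    (hβ : ∀ q : QuadraticForm k M, (β q).toQuadraticMap = q) :
    (∀ q : QuadraticForm k M,
      cliffordMul q (β q) (hβ q) ∈ specialisations k (2 ^ ℓ) (1 : EvenExterior k M)) ∧
    ∃ θ : affineSpace k (QuadraticForm k M) ⟶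
        specialisationVariety k (2 ^ ℓ) (1 : EvenExterior k M),
      θ ≫ subvarietyIncl k _ ≫ affineSpaceStr k _ = affineSpaceStr k _ ∧
      (∀ q : QuadraticForm k M,
        point k q ≫ θ ≫ subvarietyIncl k _ = point k (cliffordMul q (β q) (hβ q))) ∧
      IsClosedImmersion θ := by
  have : Module.Finite k M := Module.finite_of_finrank_pos (by omega)
  have := finite_quadraticForm hβ
  have := invertibleOfNonzero h2
  have hS (q) := cliffordMul_mem_specialisations hM q (β q) (hβ q)
  exact ⟨hS, exists_isClosedImmersion (cliffordMul_mem_polynomialMaps hβ) hS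
    (exists_dual_cliffordMul_eq (by omega) hβ)⟩

open CliffordSpecialisation in
/-- Let `k` be algebraically closed with `2 ≠ 0`, let `dim M = 2 ℓ + 1` with `ℓ ≥ 1`, and let
`n = 2 ^ ℓ`. Identify all even Clifford algebras `Cl⁺(q)` with the even exterior algebra of `M`
through bilinear forms `β q` with `β q x x = q x` that depend linearly on `q` (this covers both
antisymmetrisation and the ordered monomials in a basis of `M`). Then every `Cl⁺(q)` is a
specialisation of the algebra of `n × n` matrices, and `q ↦ Cl⁺(q)` is (on `k`-rational points) a
morphism of `k`-schemes from the affine space of quadratic forms to `𝒜ₙ` which is a closed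
immersion. -/
theorem proposition3p1 {k : Type u} [Field k] [IsAlgClosed k] (h2 : (2 : k) ≠ 0)
    {M : Type u} [AddCommGroup M] [Module k M] (ℓ : ℕ) (hℓ : 1 ≤ ℓ)
    (hM : Module.finrank k M = 2 * ℓ + 1)
    (β : QuadraticForm k M →ₗ[k] LinearMap.BilinForm k M)
    (hβ : ∀ q : QuadraticForm k M, (β q).toQuadraticMap = q) :
    (∀ q : QuadraticForm k M,
      cliffordMul q (β q) (hβ q) ∈ specialisations k (2 ^ ℓ) (1 : EvenExterior k M)) ∧
    ∃ θ : affineSpace k (QuadraticForm k M) ⟶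
        specialisationVariety k (2 ^ ℓ) (1 : EvenExterior k M),
      θ ≫ subvarietyIncl k _ ≫ affineSpaceStr k _ = affineSpaceStr k _ ∧
      (∀ q : QuadraticForm k M,
        point k q ≫ θ ≫ subvarietyIncl k _ = point k (cliffordMul q (β q) (hβ q))) ∧
      IsClosedImmersion θ :=
  proposition3p1_general h2 ℓ hℓ hM β hβ
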